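/- Let $d\ge 0$ and $n\ge 1$ be integers, let $\mathcal X$ be any set (the data universe), let $L>0$, and let $f:\mathbb R^d\times\mathcal X\to\mathbb R$ be a loss function such that for every $x\in\mathcal X$ the function $f(\cdot,x)$ is differentiable and $L$-Lipschitz in the Euclidean norm (no convexity is assumed). Let $\varepsilon\in(0,1]$, $\delta\in(0,1)$, let $\mathbb P$ be any probability distribution on $\{1,\dots,n^2\}$, and let the learning rates $\eta_0,\eta_1,\dots\in\mathbb R$ and the starting point $w_0\in\mathbb R^d$ be arbitrary, all of them chosen independently of the data. Random round private stochastic gradient descent takes a database $S=(x_1,\dots,x_n)\in\mathcal X^n$, draws $R\sim\mathbb P$, and for $t=0,\dots,R-1$ draws, independently of everything before, $\xi_t$ uniformly from the $n$ entries of $S$ and $z_t\in\mathbb R^d$ from the Gaussian distribution whose density is proportional to $$\exp\left(-\frac{\varepsilon^2\|z\|_2^2}{8L^2\log(3n/\delta)\log(2/\delta)}\right),$$ and sets $$w_{t+1}=w_t-\eta_t\bigl(\nabla f(w_t,\xi_t)+z_t\bigr).$$ Its output is $w_{\mathrm{priv}}=w_R$. Then this algorithm is $(\varepsilon,\delta)$-differentially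 private: for all $S,S'\in\mathcal X^n$ that differ in exactly one entry and every Borel set $A\subseteq\mathbb R^d$, $$\Pr\bigl(w_{\mathrm{priv}}(S)\in A\bigr)\le e^{\varepsilon}\,\Pr\bigl(w_{\mathrm{priv}}(S')\in A\bigr)+\delta .$$ -/

import Mathlib

open MeasureTheory ProbabilityTheory

noncomputable section

/-- Two databases of size `n` over the data universe `X` are neighbors if they differ in exactly
one data point. -/
def Neighboring {X : Type*} {n : ℕ} (S S' : Fin n → X) : Prop :=
  ∃ i, S i ≠ S' i ∧ ∀ j, j ≠ i → S j = S' j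

/-- A randomized algorithm on databases of size `n` with outputs in `Y`, given by its output law
`M S` on each input `S`, is `(ε, δ)`-differentially private: every `M S` is a probability measure,
and `Pr(M(S) ∈ A) ≤ e^ε Pr(M(S') ∈ A) + δ` for all neighboring `S`, `S'` and all events `A`. -/
structure IsDifferentiallyPrivate {X Y : Type*} [MeasurableSpace Y] {n : ℕ}
    (M : (Fin n → X) → Measure Y) (ε δ : ℝ) : Prop where
  isProbabilityMeasure : ∀ S, IsProbabilityMeasure (M S)
  le : ∀ S S' : Fin n → X, Neighboring S S' → ∀ A : Set Y, MeasurableSet A →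
    M S A ≤ ENNReal.ofReal (Real.exp ε) * M S' A + ENNReal.ofReal δ

/-- The probability measure on `ℝ^d` whose Lebesgue density is proportional to `g`. -/
def densityProportionalTo {d : ℕ} (g : EuclideanSpace ℝ (Fin d) → ℝ) :
    Measure (EuclideanSpace ℝ (Fin d)) :=
  ((volume.withDensity fun z => ENNReal.ofReal (g z)) Set.univ)⁻¹ •
    volume.withDensity fun z => ENNReal.ofReal (g z)

/-- The Gaussian gradient noise `z_t ∼ exp(-ε² ‖z‖² / (8 L² log(3n/δ) log(2/δ)))` on `ℝ^d`. -/
def gradientNoise (d n : ℕ) (L ε δ : ℝ) : Measure (EuclideanSpace ℝ (Fin d)) :=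
  densityProportionalTo fun z =>
    Real.exp (-(ε ^ 2 * ‖z‖ ^ 2 / (8 * L ^ 2 * Real.log (3 * n / δ) * Real.log (2 / δ))))

/-- One round started at `w`: draw a uniformly random data point of `S`, draw a noise vector `z`
from `ν`, and move to `w - η (∇f(w, ξ) + z)`. This is the law of the new point. -/
def noisySGDStep {X : Type*} {d n : ℕ} (f : EuclideanSpace ℝ (Fin d) → X → ℝ)
    (ν : Measure (EuclideanSpace ℝ (Fin d))) (S : Fin n → X) (η : ℝ)
    (w : EuclideanSpace ℝ (Fin d)) : Measure (EuclideanSpace ℝ (Fin d)) :=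
  (uniformOn (Set.univ : Set (Fin n))).bind fun i =>
    ν.map fun z => w - η • (gradient (fun u => f u (S i)) w + z)

/-- The law of the iterate `w_t`, started at the fixed point `w₀`, with fresh independent
randomness in every round; round `t` uses the learning rate `η t`. -/
def noisySGDIterate {X : Type*} {d n : ℕ} (f : EuclideanSpace ℝ (Fin d) → X → ℝ)
    (ν : Measure (EuclideanSpace ℝ (Fin d))) (η : ℕ → ℝ) (w₀ : EuclideanSpace ℝ (Fin d))
    (S : Fin n → X) : ℕ → Measure (EuclideanSpace ℝ (Fin d))
  | 0 => Measure.dirac w₀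
  | t + 1 => (noisySGDIterate f ν η w₀ S t).bind (noisySGDStep f ν S (η t))

/-- Random round private stochastic gradient descent: draw the number of rounds `R` from `P`, run
`R` noisy rounds (`t = 0, …, R - 1`) from `w₀`, and output `w_R`. This is the law of the output on
the database `S`. -/
def randomRoundPrivateSGD {X : Type*} {d n : ℕ} (f : EuclideanSpace ℝ (Fin d) → X → ℝ)
    (L ε δ : ℝ) (P : PMF ℕ) (η : ℕ → ℝ) (w₀ : EuclideanSpace ℝ (Fin d)) (S : Fin n → X) :
    Measure (EuclideanSpace ℝ (Fin d)) :=
  P.toMeasure.bind (noisySGDIterate f (gradientNoise d n L ε δ) η w₀ S)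

end

/-!
The proof works with moments of density ratios (Rényi divergences) instead of tail bounds for the
privacy loss. Fix an order `k + 1`. If `∫ (dμ/dν)^(k+1) dν ≤ B` holds for the output laws `μ`, `ν` on
two neighboring databases, then `μ A ≤ B^{1/(k+1)} (ν A)^{k/(k+1)}` by Hölder's inequality, and
weighted AM-GM turns this into `(ε, δ)`-privacy as soon as `B ≤ 2 (k + 1) δ e^{kε}`
(`DensityMomentLE.measure_le`). The moment bound is encoded by its Hölder dual `DensityMomentLE`,
which is meaningful for singular laws as well (a learning rate may be `0`), passes to images and
mixtures, and multiplies along the rounds of a Markov chain (`DensityMomentLE.bind`).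

In one round with `n ≥ 2`, conditioning on a second index reduces the two laws to
`P = (1 - p) G + p P₁` and `Q = (1 - p) G + p P₂` with `p = 1 / n`, where `G`, `P₁`, `P₂` are Gaussians
with the same covariance and means at distance at most `2 L`. Since `P = Q + p (P₁ - P₂)`, the
first-order term of `∫ P^(k+1) / Q^k` vanishes, and `∫ P^(k+1) / Q^k ≤ 1 + p² K`, where `K` consists of
moments of pairs of Gaussians. The pointwise inequality behind this is `mixture_pow_div_le`. It rests
on the fact that the Taylor remainder `h(t) = (1 + t)^(k+1) - 1 - (k + 1) t` satisfies
`h(p t) ≤ p² h(t)` for `t ≥ 0`, and that `q h((x - y) / q)` is controlled by the same expression with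
one of the unmixed densities in place of `q`.

Over at most `n² = 1 / p²` rounds the moment is therefore at most `(1 + K / n²)^(n²) ≤ e^K`. It remains
to choose the order: `k = ⌊log (2 / δ) / ε⌋` works if this is at least `2` (`moment_budget`), and
otherwise the second moment, for which a sharper `K` is available, is enough (`chiSq_budget`). For
`n = 1` there is a single round and no mixture, and the exact Gaussian moment is used
(`gaussian_budget`).
-/

open scoped ENNReal

/-! ### Moments of density ratios -/

/-- `μ` has density moment of order `k + 1` at most `B` with respect to `ν`, that is
`∫ (dμ/dν)^(k+1) dν ≤ B`, in the dual form given by Hölder's inequality with the conjugate exponents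
`k + 1` and `(k + 1) / k`. The dual form mentions no density, so that it also makes sense for
measures which are singular with respect to Lebesgue measure (such as `Measure.dirac`). -/
def DensityMomentLE {Y : Type*} [MeasurableSpace Y] (k : ℕ) (B : ℝ≥0∞) (μ ν : Measure Y) : Prop :=
  ∀ φ : Y → ℝ≥0∞, Measurable φ →
    ∫⁻ y, φ y ∂μ ≤
      B ^ (1 / (k + 1) : ℝ) * (∫⁻ y, φ y ^ ((k + 1) / k : ℝ) ∂ν) ^ (k / (k + 1) : ℝ)

lemma succ_div_mul_div_succ {k : ℕ} (hk : 1 ≤ k) :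
    ((k + 1) / k : ℝ) * (k / (k + 1)) = 1 := by
  have : (0 : ℝ) < k := by exact_mod_cast hk
  field_simp

namespace DensityMomentLE

variable {Y Z : Type*} [MeasurableSpace Y] [MeasurableSpace Z] {k : ℕ} {B B' : ℝ≥0∞}

lemma dirac (hk : 1 ≤ k) (y : Y) : DensityMomentLE k 1 (Measure.dirac y) (Measure.dirac y) := by
  intro φ hφ
  rw [lintegral_dirac' _ hφ, lintegral_dirac' _ (hφ.pow_const _), ← ENNReal.rpow_mul,
    succ_div_mul_div_succ hk]
  simp

/-- Moments multiply along the steps of a Markov chain whose transitions are compared uniformly. -/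
lemma bind (hk : 1 ≤ k) {μ ν : Measure Y} {κ κ' : Y → Measure Z}
    (hκ : Measurable κ) (hκ' : Measurable κ') (h : DensityMomentLE k B μ ν)
    (h' : ∀ y, DensityMomentLE k B' (κ y) (κ' y)) :
    DensityMomentLE k (B * B') (μ.bind κ) (ν.bind κ') := by
  intro φ hφ
  set q : ℝ := (k + 1) / k
  set r : ℝ := k / (k + 1)
  have hr : r * q = 1 := by rw [mul_comm]; exact succ_div_mul_div_succ hk
  have hφq : Measurable fun z => φ z ^ q := hφ.pow_const _
  have hm : Measurable fun y => ∫⁻ z, φ z ^ q ∂κ' y :=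
    (Measure.measurable_lintegral hφq).comp hκ'
  rw [Measure.lintegral_bind hκ.aemeasurable hφ.aemeasurable,
    Measure.lintegral_bind hκ'.aemeasurable hφq.aemeasurable]
  calc ∫⁻ y, ∫⁻ z, φ z ∂κ y ∂μ
      ≤ ∫⁻ y, B' ^ (1 / (k + 1) : ℝ) * (∫⁻ z, φ z ^ q ∂κ' y) ^ r ∂μ :=
        lintegral_mono fun y => h' y φ hφ
    _ = B' ^ (1 / (k + 1) : ℝ) * ∫⁻ y, (∫⁻ z, φ z ^ q ∂κ' y) ^ r ∂μ :=
        lintegral_const_mul _ (hm.pow_const _)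
    _ ≤ B' ^ (1 / (k + 1) : ℝ) * (B ^ (1 / (k + 1) : ℝ) *
          (∫⁻ y, ((∫⁻ z, φ z ^ q ∂κ' y) ^ r) ^ q ∂ν) ^ r) := by
        gcongr
        exact h _ (hm.pow_const _)
    _ = (B * B') ^ (1 / (k + 1) : ℝ) * (∫⁻ y, ∫⁻ z, φ z ^ q ∂κ' y ∂ν) ^ r := by
        simp_rw [← ENNReal.rpow_mul, hr, ENNReal.rpow_one]
        rw [ENNReal.mul_rpow_of_nonneg _ _ (by positivity)]
        ring

lemma map {μ ν : Measure Y} (h : DensityMomentLE k B μ ν) {T : Y → Z}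
    (hT : Measurable T) : DensityMomentLE k B (μ.map T) (ν.map T) := by
  intro φ hφ
  rw [lintegral_map hφ hT, lintegral_map (hφ.pow_const _) hT]
  exact h _ (hφ.comp hT)

/-- A convex combination of pairs of measures inherits a common bound on the moments. -/
lemma sum_smul (hk : 1 ≤ k) {ι : Type*} (s : Finset ι) (w : ι → ℝ≥0∞) (hw : ∑ i ∈ s, w i = 1)
    {μ ν : ι → Measure Y} (h : ∀ i ∈ s, DensityMomentLE k B (μ i) (ν i)) :
    DensityMomentLE k B (∑ i ∈ s, w i • μ i) (∑ i ∈ s, w i • ν i) := by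
  intro φ hφ
  have hk' : (0 : ℝ) < k := by exact_mod_cast hk
  set q : ℝ := (k + 1) / k
  set r : ℝ := k / (k + 1)
  have hqr : q * r = 1 := succ_div_mul_div_succ hk
  have hq : 1 ≤ q := by rw [one_le_div hk']; linarith
  have hr : 0 ≤ r := by positivity
  simp only [lintegral_finsetSum_measure, lintegral_smul_measure, smul_eq_mul]
  set J : ι → ℝ≥0∞ := fun i => ∫⁻ y, φ y ^ q ∂ν i
  calc ∑ i ∈ s, w i * ∫⁻ y, φ y ∂μ i
      ≤ ∑ i ∈ s, w i * (B ^ (1 / (k + 1) : ℝ) * J i ^ r) :=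
        Finset.sum_le_sum fun i hi => by gcongr; exact h i hi φ hφ
    _ = B ^ (1 / (k + 1) : ℝ) * ∑ i ∈ s, w i * J i ^ r := by
        rw [Finset.mul_sum]; exact Finset.sum_congr rfl fun i _ => by ring
    _ ≤ B ^ (1 / (k + 1) : ℝ) * (∑ i ∈ s, w i * J i) ^ r := by
        gcongr
        have := ENNReal.rpow_le_rpow
          (ENNReal.rpow_arith_mean_le_arith_mean_rpow s w (fun i => J i ^ r) hw hq) hr
        rw [← ENNReal.rpow_mul, hqr, ENNReal.rpow_one] at this
        refine this.trans_eq ?_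
        simp_rw [← ENNReal.rpow_mul, mul_comm r q, hqr, ENNReal.rpow_one]

/-- For measures with positive densities `p` and `q`, the bound follows from
`∫ p^(k+1) / q^k ≤ B` by Hölder's inequality. -/
lemma of_density (hk : 1 ≤ k) {m : Measure Y} {p q : Y → ℝ} (hp : Measurable p)
    (hq : Measurable q) (hp0 : ∀ y, 0 < p y) (hq0 : ∀ y, 0 < q y)
    (h : ∫⁻ y, ENNReal.ofReal (p y ^ (k + 1) / q y ^ k) ∂m ≤ B) :
    DensityMomentLE k B (m.withDensity fun y => ENNReal.ofReal (p y))
      (m.withDensity fun y => ENNReal.ofReal (q y)) := by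
  intro φ hφ
  have hk' : (0 : ℝ) < k := by exact_mod_cast hk
  have hconj : Real.HolderConjugate ((k : ℝ) + 1) ((k + 1) / k) := by
    rw [Real.holderConjugate_iff]
    refine ⟨by linarith, ?_⟩
    field_simp
    ring
  set r : ℝ := k / (k + 1)
  have hr : r * ((k + 1) / k) = 1 := by rw [mul_comm]; exact succ_div_mul_div_succ hk
  rw [lintegral_withDensity_eq_lintegral_mul _ hp.ennreal_ofReal hφ,
    lintegral_withDensity_eq_lintegral_mul _ hq.ennreal_ofReal (hφ.pow_const _)]
  -- split the density as `p = (p q^{-r}) q^r` with `r = k / (k + 1)`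
  have hsplit : ∀ y, ENNReal.ofReal (p y) * φ y =
      ENNReal.ofReal (p y * (q y ^ r)⁻¹) * (ENNReal.ofReal (q y ^ r) * φ y) := by
    intro y
    have := Real.rpow_pos_of_pos (hq0 y) r
    rw [← mul_assoc, ← ENNReal.ofReal_mul (by have := hp0 y; positivity)]
    congr 2
    field_simp
  have hleft : ∀ y, ENNReal.ofReal (p y * (q y ^ r)⁻¹) ^ ((k : ℝ) + 1) =
      ENNReal.ofReal (p y ^ (k + 1) / q y ^ k) := by
    intro y
    have h1 := Real.rpow_pos_of_pos (hq0 y) r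
    rw [ENNReal.ofReal_rpow_of_pos (mul_pos (hp0 y) (inv_pos.2 h1))]
    congr 1
    rw [Real.mul_rpow (hp0 y).le (inv_pos.2 h1).le, Real.inv_rpow h1.le, ← Real.rpow_mul (hq0 y).le,
      show r * ((k : ℝ) + 1) = k by simp only [r]; field_simp, Real.rpow_natCast,
      div_eq_mul_inv]
    congr 1
    exact_mod_cast Real.rpow_natCast (p y) (k + 1)
  have hright : ∀ y, (ENNReal.ofReal (q y ^ r) * φ y) ^ ((k + 1) / k : ℝ) =
      ENNReal.ofReal (q y) * φ y ^ ((k + 1) / k : ℝ) := by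
    intro y
    rw [ENNReal.mul_rpow_of_nonneg _ _ (by positivity),
      ENNReal.ofReal_rpow_of_pos (Real.rpow_pos_of_pos (hq0 y) r), ← Real.rpow_mul (hq0 y).le, hr,
      Real.rpow_one]
  have := ENNReal.lintegral_mul_le_Lp_mul_Lq m hconj
    (f := fun y => ENNReal.ofReal (p y * (q y ^ r)⁻¹))
    (g := fun y => ENNReal.ofReal (q y ^ r) * φ y)
    (hp.mul (hq.pow_const r).inv).ennreal_ofReal.aemeasurable
    ((hq.pow_const r).ennreal_ofReal.mul hφ).aemeasurable
  simp only [Pi.mul_apply, hleft, hright] at this ⊢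
  simp_rw [hsplit]
  refine this.trans ?_
  rw [show 1 / (((k : ℝ) + 1) / k) = r by simp only [r]; field_simp]
  gcongr

/-- Conversion of a moment bound into a privacy guarantee: for an event `A` the moment bound reads
`μ A ≤ B^{1/(k+1)} (ν A)^{k/(k+1)}`, and the right-hand side is split by the weighted inequality
of arithmetic and geometric means. -/
lemma measure_le (hk : 1 ≤ k) {μ ν : Measure Y} [IsProbabilityMeasure ν] {b ε δ : ℝ} (hb : 0 ≤ b)
    (h : DensityMomentLE k (ENNReal.ofReal b) μ ν)
    (hbound : b ≤ 2 * (k + 1) * δ * Real.exp (k * ε)) {A : Set Y} (hA : MeasurableSet A) :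
    μ A ≤ ENNReal.ofReal (Real.exp ε) * ν A + ENNReal.ofReal δ := by
  have hk' : (0 : ℝ) < k := by exact_mod_cast hk
  have hδ : 0 ≤ δ := by
    by_contra hneg
    have : 0 < 2 * ((k : ℝ) + 1) * Real.exp (k * ε) := by positivity
    nlinarith
  have h1 := h (A.indicator 1) (measurable_one.indicator hA)
  have hq : (0 : ℝ) < (k + 1) / k := by positivity
  have hind : (fun y => (A.indicator 1 y : ℝ≥0∞) ^ ((k + 1) / k : ℝ)) = A.indicator 1 := by
    funext y
    by_cases hy : y ∈ A <;> simp [hy, ENNReal.zero_rpow_of_pos hq]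
  rw [hind, lintegral_indicator_one hA, lintegral_indicator_one hA] at h1
  refine h1.trans ?_
  set x : ℝ := (ν A).toReal
  have hx : ν A = ENNReal.ofReal x := (ENNReal.ofReal_toReal (measure_ne_top ν A)).symm
  have hx0 : 0 ≤ x := ENNReal.toReal_nonneg
  rw [hx, ENNReal.ofReal_rpow_of_nonneg hb (by positivity),
    ENNReal.ofReal_rpow_of_nonneg hx0 (by positivity), ← ENNReal.ofReal_mul (by positivity),
    ← ENNReal.ofReal_mul (by positivity), ← ENNReal.ofReal_add (by positivity) hδ]
  apply ENNReal.ofReal_le_ofReal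
  -- the rescaling for which the weighted mean of the second factor is exactly `e^ε x`
  set c : ℝ := Real.exp ε * ((k + 1) / k) with hc
  have hc0 : 0 < c := by positivity
  have hamgm := Real.geom_mean_le_arith_mean2_weighted (w₁ := 1 / (k + 1)) (w₂ := k / (k + 1))
    (p₁ := b / c ^ k) (p₂ := c * x) (by positivity) (by positivity) (by positivity) (by positivity)
    (by field_simp; ring)
  have hlhs : (b / c ^ k) ^ (1 / (k + 1) : ℝ) * (c * x) ^ (k / (k + 1) : ℝ) =
      b ^ (1 / (k + 1) : ℝ) * x ^ (k / (k + 1) : ℝ) := by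
    rw [Real.div_rpow hb (by positivity), Real.mul_rpow hc0.le hx0, ← Real.rpow_natCast c k,
      ← Real.rpow_mul hc0.le, show (k : ℝ) * (1 / (k + 1)) = k / (k + 1) by ring]
    have := Real.rpow_pos_of_pos hc0 (k / (k + 1))
    field_simp
  rw [hlhs] at hamgm
  refine hamgm.trans ?_
  have hsecond : (k / (k + 1) : ℝ) * (c * x) = Real.exp ε * x := by
    rw [hc]; field_simp
  have hpow : 2 * Real.exp (k * ε) ≤ c ^ k := by
    rw [hc, mul_pow, ← Real.exp_nat_mul, mul_comm]
    gcongr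
    have hbern := one_add_mul_le_pow (a := (1 / k : ℝ))
      (by have : (0 : ℝ) ≤ 1 / k := by positivity
          linarith) k
    rw [mul_one_div_cancel hk'.ne'] at hbern
    calc (2 : ℝ) = 1 + 1 := by norm_num
      _ ≤ (1 + 1 / k) ^ k := hbern
      _ = ((k + 1) / k : ℝ) ^ k := by congr 1; field_simp
  have hfirst : (1 / (k + 1) : ℝ) * (b / c ^ k) ≤ δ := by
    rw [one_div_mul_eq_div, div_le_iff₀ (by positivity), div_le_iff₀ (by positivity)]
    calc b ≤ 2 * (k + 1) * δ * Real.exp (k * ε) := hbound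
      _ = δ * (k + 1) * (2 * Real.exp (k * ε)) := by ring
      _ ≤ δ * (k + 1) * c ^ k := by gcongr
  linarith

end DensityMomentLE

/-! ### Pointwise inequalities for mixtures -/

/-- The remainder of the first-order Taylor expansion of `t ↦ (1 + t)^(k+1)` at `0`. -/
noncomputable def powRemainder (k : ℕ) (t : ℝ) : ℝ := (1 + t) ^ (k + 1) - 1 - (k + 1) * t

lemma powRemainder_succ (k : ℕ) (t : ℝ) :
    powRemainder (k + 1) t = powRemainder k t + t * powRemainder k t + (k + 1) * t ^ 2 := by
  simp only [powRemainder]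
  push_cast
  ring

lemma powRemainder_nonneg {k : ℕ} {t : ℝ} (ht : -1 ≤ t) : 0 ≤ powRemainder k t := by
  have := one_add_mul_le_pow (a := t) (by linarith) (k + 1)
  push_cast at this
  simp only [powRemainder]
  linarith

lemma powRemainder_mono {k : ℕ} {s t : ℝ} (hs : 0 ≤ s) (hst : s ≤ t) :
    powRemainder k s ≤ powRemainder k t := by
  induction k with
  | zero => simp [powRemainder]
  | succ k ih =>
    have h0 := powRemainder_nonneg (k := k) (t := s) (by linarith)
    have ht : 0 ≤ t := hs.trans hst
    rw [powRemainder_succ, powRemainder_succ]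
    gcongr

/-- Since `powRemainder k t / t ^ 2` increases on `t ≥ 0`, shrinking `t` by a factor `p` gains a
factor `p ^ 2`. This is where subsampling with probability `p` pays off quadratically. -/
lemma powRemainder_mul_le {k : ℕ} {p t : ℝ} (hp0 : 0 ≤ p) (hp1 : p ≤ 1) (ht : 0 ≤ t) :
    powRemainder k (p * t) ≤ p ^ 2 * powRemainder k t := by
  induction k with
  | zero => simp [powRemainder]
  | succ k ih =>
    have h0 := powRemainder_nonneg (k := k) (t := t) (by linarith)
    rw [powRemainder_succ, powRemainder_succ]
    have h1 : p * t * powRemainder k (p * t) ≤ 1 * t * (p ^ 2 * powRemainder k t) := by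
      gcongr
      exact powRemainder_nonneg (by nlinarith)
    linarith

lemma powRemainder_le_of_nonpos {k : ℕ} {t : ℝ} (ht : -1 ≤ t) (ht0 : t ≤ 0) :
    powRemainder k t ≤ k * (k + 1) / 2 * t ^ 2 := by
  induction k with
  | zero => simp [powRemainder]
  | succ k ih =>
    have h0 := powRemainder_nonneg (k := k) (t := t) ht
    rw [powRemainder_succ]
    push_cast
    nlinarith

/-- The perspective `u ↦ u * powRemainder k (s / u)` is antitone. -/
lemma mul_powRemainder_div_le {k : ℕ} {s u v : ℝ} (hs : 0 ≤ s) (hu : 0 < u) (huv : u ≤ v) :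
    v * powRemainder k (s / v) ≤ u * powRemainder k (s / u) := by
  have hv : 0 < v := hu.trans_le huv
  have h := powRemainder_mul_le (k := k) (p := u / v) (t := s / u) (by positivity)
    ((div_le_one hv).2 huv) (by positivity)
  have h0 := powRemainder_nonneg (k := k) (t := s / u)
    (by have : 0 ≤ s / u := by positivity
        linarith)
  have heq : u / v * (s / u) = s / v := by field_simp
  rw [heq] at h
  calc v * powRemainder k (s / v) ≤ v * ((u / v) ^ 2 * powRemainder k (s / u)) := by gcongr
    _ = u * (u / v) * powRemainder k (s / u) := by field_simp
    _ ≤ u * 1 * powRemainder k (s / u) := by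
        gcongr
        exact (div_le_one hv).2 huv
    _ = u * powRemainder k (s / u) := by ring

lemma mul_powRemainder_sub_div {k : ℕ} {x u : ℝ} (hu : 0 < u) :
    u * powRemainder k ((x - u) / u) = x ^ (k + 1) / u ^ k - u - (k + 1) * (x - u) := by
  have : 1 + (x - u) / u = x / u := by field_simp; ring
  simp only [powRemainder, this, div_pow, pow_succ]
  field_simp

/-- The second order term for two densities `x`, `y` mixed with the same density `g` at weight
`1 - p`, by convexity of `u ↦ 1 / u`. -/
lemma mixture_sq_div_le {p g x y : ℝ} (hp0 : 0 ≤ p) (hp1 : p ≤ 1) (hg : 0 < g) (hy : 0 < y) :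
    ((1 - p) * g + p * x) ^ 2 / ((1 - p) * g + p * y) ≤
      ((1 - p) * g + p * y) + 2 * p * (x - y) +
        p ^ 2 * ((1 - p) * ((x - y) ^ 2 / g) + p * ((x - y) ^ 2 / y)) := by
  have hp1' : 0 ≤ 1 - p := by linarith
  set q := (1 - p) * g + p * y with hq
  have hq0 : 0 < q := by
    rcases hp0.eq_or_lt with rfl | h
    · simpa [hq] using hg
    · have := mul_pos h hy
      positivity
  have hx : (1 - p) * g + p * x = q + p * (x - y) := by rw [hq]; ring
  have hinv : 1 / q ≤ (1 - p) / g + p / y := by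
    rw [div_le_iff₀ hq0, hq]
    have : ((1 - p) / g + p / y) * ((1 - p) * g + p * y) =
        1 + p * (1 - p) * ((g - y) ^ 2 / (g * y)) := by
      field_simp
      ring
    rw [this]
    have : 0 ≤ p * (1 - p) * ((g - y) ^ 2 / (g * y)) := by positivity
    linarith
  calc ((1 - p) * g + p * x) ^ 2 / q
      = q + 2 * p * (x - y) + p ^ 2 * ((x - y) ^ 2 * (1 / q)) := by
        rw [hx]
        field_simp
        ring
    _ ≤ q + 2 * p * (x - y) + p ^ 2 * ((x - y) ^ 2 * ((1 - p) / g + p / y)) := by gcongr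
    _ = _ := by ring

/-- Pointwise comparison of the moment of a pair of mixtures with moments of pairs of unmixed
densities. The mixtures differ by `p * (x - y)`, whose first-order contribution integrates to zero,
and all other terms carry a factor `p ^ 2`. -/
lemma mixture_pow_div_le {k : ℕ} {p g x y : ℝ} (hp0 : 0 ≤ p) (hp1 : p ≤ 1) (hg : 0 < g)
    (hx : 0 < x) (hy : 0 < y) :
    ((1 - p) * g + p * x) ^ (k + 1) / ((1 - p) * g + p * y) ^ k ≤
      ((1 - p) * g + p * y) + (k + 1) * p * (x - y) +
        p ^ 2 * ((x ^ (k + 1) / g ^ k - g - (k + 1) * (x - g)) +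
          (x ^ (k + 1) / y ^ k - y - (k + 1) * (x - y)) +
          k * (k + 1) / 2 * ((y ^ 2 / x - 2 * y + x) + (y ^ 2 / g - 2 * y + g))) := by
  have hp1' : 0 ≤ 1 - p := by linarith
  set q := (1 - p) * g + p * y with hq
  have hmix : ∀ z, 0 < z → 0 < (1 - p) * g + p * z := fun z hz => by
    rcases hp0.eq_or_lt with rfl | h
    · simpa using hg
    · have := mul_pos h hz
      positivity
  have hq0 : 0 < q := hmix y hy
  have hP0 := hmix x hx
  have hPq : (1 - p) * g + p * x = q * (1 + p * ((x - y) / q)) := by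
    field_simp
    rw [hq]; ring
  have hexp : ((1 - p) * g + p * x) ^ (k + 1) / q ^ k =
      q + (k + 1) * p * (x - y) + q * powRemainder k (p * ((x - y) / q)) := by
    rw [hPq, mul_pow, powRemainder]
    field_simp
    ring
  rw [hexp]
  have hA : 0 ≤ x ^ (k + 1) / g ^ k - g - (k + 1) * (x - g) := by
    rw [← mul_powRemainder_sub_div hg]
    refine mul_nonneg hg.le (powRemainder_nonneg ?_)
    rw [le_div_iff₀ hg]; linarith
  have hB : 0 ≤ x ^ (k + 1) / y ^ k - y - (k + 1) * (x - y) := by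
    rw [← mul_powRemainder_sub_div hy]
    refine mul_nonneg hy.le (powRemainder_nonneg ?_)
    rw [le_div_iff₀ hy]; linarith
  have hsq : ∀ u, 0 < u → y ^ 2 / u - 2 * y + u = (y - u) ^ 2 / u := fun u hu => by
    field_simp
    ring
  rw [hsq x hx, hsq g hg]
  have hC : 0 ≤ (y - x) ^ 2 / x := by positivity
  have hD : 0 ≤ (y - g) ^ 2 / g := by positivity
  set A := x ^ (k + 1) / g ^ k - g - (k + 1) * (x - g) with hAdef
  set B := x ^ (k + 1) / y ^ k - y - (k + 1) * (x - y) with hBdef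
  have hkk : (0 : ℝ) ≤ k * (k + 1) / 2 := by positivity
  have hgoal : q * powRemainder k (p * ((x - y) / q)) ≤
      p ^ 2 * (A + B + k * (k + 1) / 2 * ((y - x) ^ 2 / x + (y - g) ^ 2 / g)) := by
    rcases le_total y x with hyx | hxy
    · have hs : 0 ≤ x - y := by linarith
      have hmain : q * powRemainder k ((x - y) / q) ≤ A + B := by
        rcases le_total y g with hyg | hgy
        · have hyq : y ≤ q := by rw [hq]; nlinarith
          have := mul_powRemainder_div_le (k := k) hs hy hyq
          rw [mul_powRemainder_sub_div hy] at this
          linarith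
        · have hgq : g ≤ q := by rw [hq]; nlinarith
          have h1 := mul_powRemainder_div_le (k := k) hs hg hgq
          have h2 : g * powRemainder k ((x - y) / g) ≤ g * powRemainder k ((x - g) / g) := by
            gcongr
            exact powRemainder_mono (by positivity) (by gcongr)
          rw [mul_powRemainder_sub_div hg] at h2
          linarith
      have h3 := powRemainder_mul_le (k := k) hp0 hp1 (t := (x - y) / q) (by positivity)
      calc q * powRemainder k (p * ((x - y) / q))
          ≤ q * (p ^ 2 * powRemainder k ((x - y) / q)) := by gcongr
        _ = p ^ 2 * (q * powRemainder k ((x - y) / q)) := by ring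
        _ ≤ p ^ 2 * (A + B) := by gcongr
        _ ≤ _ := by
          gcongr p ^ 2 * ?_
          have : 0 ≤ (k * (k + 1) / 2 : ℝ) * ((y - x) ^ 2 / x + (y - g) ^ 2 / g) := by positivity
          linarith
    · have ht0 : p * ((x - y) / q) ≤ 0 :=
        mul_nonpos_of_nonneg_of_nonpos hp0
          (div_nonpos_of_nonpos_of_nonneg (by linarith) hq0.le)
      have ht1 : -1 ≤ p * ((x - y) / q) := by
        rw [hPq] at hP0
        have := (mul_pos_iff_of_pos_left hq0).1 hP0
        linarith
      have hmain : (x - y) ^ 2 / q ≤ (y - x) ^ 2 / x + (y - g) ^ 2 / g := by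
        rcases le_total y g with hyg | hgy
        · have hxq : x ≤ q := hxy.trans (by rw [hq]; nlinarith)
          have : (x - y) ^ 2 / q ≤ (x - y) ^ 2 / x := by gcongr
          rw [show (x - y) ^ 2 = (y - x) ^ 2 by ring] at this ⊢
          linarith
        · have hgq : g ≤ q := by rw [hq]; nlinarith
          rcases le_total x g with hxg | hgx
          · have : (x - y) ^ 2 / q ≤ (x - y) ^ 2 / x := by
              gcongr
              exact hxg.trans hgq
            rw [show (x - y) ^ 2 = (y - x) ^ 2 by ring] at this ⊢
            linarith
          · have h1 : (x - y) ^ 2 / q ≤ (x - y) ^ 2 / g := by gcongr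
            have h2 : (x - y) ^ 2 / g ≤ (y - g) ^ 2 / g := by
              gcongr ?_ / _
              nlinarith
            linarith
      calc q * powRemainder k (p * ((x - y) / q))
          ≤ q * (k * (k + 1) / 2 * (p * ((x - y) / q)) ^ 2) := by
            gcongr
            exact powRemainder_le_of_nonpos ht1 ht0
        _ = p ^ 2 * (k * (k + 1) / 2 * ((x - y) ^ 2 / q)) := by
            field_simp
        _ ≤ p ^ 2 * (k * (k + 1) / 2 * ((y - x) ^ 2 / x + (y - g) ^ 2 / g)) := by gcongr
        _ ≤ _ := by
          gcongr p ^ 2 * ?_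
          linarith
  linarith

/-! ### Gaussian moments -/

/-- `f` is integrable with integral `v`. -/
def IntegratesTo {Y : Type*} [MeasureSpace Y] (f : Y → ℝ) (v : ℝ) : Prop :=
  Integrable f ∧ ∫ y, f y = v

namespace IntegratesTo

variable {Y : Type*} [MeasureSpace Y] {f g : Y → ℝ} {v w : ℝ}

lemma add (hf : IntegratesTo f v) (hg : IntegratesTo g w) :
    IntegratesTo (fun y => f y + g y) (v + w) :=
  ⟨hf.1.add hg.1, by rw [integral_add hf.1 hg.1, hf.2, hg.2]⟩

lemma sub (hf : IntegratesTo f v) (hg : IntegratesTo g w) :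
    IntegratesTo (fun y => f y - g y) (v - w) :=
  ⟨hf.1.sub hg.1, by rw [integral_sub hf.1 hg.1, hf.2, hg.2]⟩

lemma const_mul (c : ℝ) (hf : IntegratesTo f v) : IntegratesTo (fun y => c * f y) (c * v) :=
  ⟨hf.1.const_mul c, by rw [integral_const_mul, hf.2]⟩

lemma lintegral_le (hg : IntegratesTo g v) (hf : ∀ y, 0 ≤ f y) (hfg : ∀ y, f y ≤ g y) (hvw : v ≤ w) :
    ∫⁻ y, ENNReal.ofReal (f y) ≤ ENNReal.ofReal w := by
  refine (lintegral_mono fun y => ENNReal.ofReal_le_ofReal (hfg y)).trans ?_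
  rw [← ofReal_integral_eq_lintegral_ofReal hg.1 (ae_of_all _ fun y => (hf y).trans (hfg y)), hg.2]
  exact ENNReal.ofReal_le_ofReal hvw

end IntegratesTo

section GaussianDensity

variable {V : Type*} [NormedAddCommGroup V] [InnerProductSpace ℝ V] [FiniteDimensional ℝ V]
  [MeasurableSpace V] [BorelSpace V]

/-- The density of the isotropic Gaussian distribution with mean `a` and precision `2 * τ`. -/
noncomputable def gaussianDensity (τ : ℝ) (a x : V) : ℝ :=
  Real.exp (-(τ * ‖x - a‖ ^ 2)) / ∫ z : V, Real.exp (-(τ * ‖z‖ ^ 2))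

variable {τ : ℝ}

lemma integral_exp_neg_mul_sq_norm_pos (hτ : 0 < τ) :
    0 < ∫ z : V, Real.exp (-(τ * ‖z‖ ^ 2)) := by
  have := GaussianFourier.integral_rexp_neg_mul_sq_norm (V := V) hτ
  simp only [neg_mul] at this
  rw [this]
  positivity

lemma integrable_exp_neg_mul_sq_norm' (hτ : 0 < τ) :
    Integrable fun z : V => Real.exp (-(τ * ‖z‖ ^ 2)) :=
  not_imp_comm.1 integral_undef (integral_exp_neg_mul_sq_norm_pos hτ).ne'

lemma gaussianDensity_pos (hτ : 0 < τ) (a x : V) : 0 < gaussianDensity τ a x :=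
  div_pos (Real.exp_pos _) (integral_exp_neg_mul_sq_norm_pos hτ)

lemma measurable_gaussianDensity (a : V) : Measurable (gaussianDensity τ a) := by
  unfold gaussianDensity
  fun_prop

lemma integratesTo_gaussianDensity (hτ : 0 < τ) (a : V) : IntegratesTo (gaussianDensity τ a) 1 := by
  refine ⟨((integrable_exp_neg_mul_sq_norm' hτ).comp_sub_right a).div_const _, ?_⟩
  simp only [gaussianDensity]
  rw [integral_div, integral_sub_right_eq_self (fun z : V => Real.exp (-(τ * ‖z‖ ^ 2))) a,
    div_self (integral_exp_neg_mul_sq_norm_pos hτ).ne']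

/-- The moment of order `k + 1` of the density ratio of two Gaussians, by completing the square. -/
lemma integratesTo_gaussianDensity_pow_div (hτ : 0 < τ) (k : ℕ) (a c : V) :
    IntegratesTo (fun x => gaussianDensity τ a x ^ (k + 1) / gaussianDensity τ c x ^ k)
      (Real.exp (k * (k + 1) * (τ * ‖a - c‖ ^ 2))) := by
  have h := (integratesTo_gaussianDensity hτ (a + (k : ℝ) • (a - c))).const_mul
    (Real.exp (k * (k + 1) * (τ * ‖a - c‖ ^ 2)))
  rw [mul_one] at h
  convert h using 2 with x
  have hZ := integral_exp_neg_mul_sq_norm_pos (V := V) hτ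
  simp only [gaussianDensity, div_pow, ← Real.exp_nat_mul]
  set Z := ∫ z : V, Real.exp (-(τ * ‖z‖ ^ 2))
  have hsq : ‖x - (a + (k : ℝ) • (a - c))‖ ^ 2 =
      (k + 1) * ‖x - a‖ ^ 2 - k * ‖x - c‖ ^ 2 + k * (k + 1) * ‖a - c‖ ^ 2 := by
    rw [show x - (a + (k : ℝ) • (a - c)) = (x - a) - (k : ℝ) • ((x - c) - (x - a)) by
        rw [sub_sub_sub_cancel_left]; abel,
      show a - c = (x - c) - (x - a) by abel]
    generalize x - a = u
    generalize x - c = v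
    simp only [norm_sub_sq_real, inner_smul_right, norm_smul, mul_pow, inner_sub_right,
      real_inner_self_eq_norm_sq, Real.norm_eq_abs, sq_abs, real_inner_comm u v]
    ring
  rw [hsq, div_div_div_eq, mul_div_assoc', ← Real.exp_add, div_eq_div_iff (by positivity) hZ.ne',
    show Real.exp (↑k * (↑k + 1) * (τ * ‖a - c‖ ^ 2) + -(τ * ((↑k + 1) * ‖x - a‖ ^ 2 -
      ↑k * ‖x - c‖ ^ 2 + ↑k * (↑k + 1) * ‖a - c‖ ^ 2))) =
      Real.exp (↑(k + 1) * -(τ * ‖x - a‖ ^ 2)) / Real.exp (↑k * -(τ * ‖x - c‖ ^ 2)) by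
    rw [← Real.exp_sub]; congr 1; push_cast; ring]
  field_simp
  ring

lemma integratesTo_gaussianDensity_sq_div (hτ : 0 < τ) (a c : V) :
    IntegratesTo (fun x => gaussianDensity τ a x ^ 2 / gaussianDensity τ c x)
      (Real.exp (2 * (τ * ‖a - c‖ ^ 2))) := by
  have := integratesTo_gaussianDensity_pow_div hτ 1 a c
  norm_num at this
  exact this

lemma integratesTo_gaussianDensity_mul_div (hτ : 0 < τ) (a b c : V) :
    IntegratesTo (fun x => gaussianDensity τ a x * gaussianDensity τ b x / gaussianDensity τ c x)
      (Real.exp (τ * (‖a - c‖ ^ 2 + ‖b - c‖ ^ 2 - ‖a - b‖ ^ 2))) := by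
  have h := (integratesTo_gaussianDensity hτ (a + (b - c))).const_mul
    (Real.exp (τ * (‖a - c‖ ^ 2 + ‖b - c‖ ^ 2 - ‖a - b‖ ^ 2)))
  rw [mul_one] at h
  convert h using 2 with x
  have hZ := integral_exp_neg_mul_sq_norm_pos (V := V) hτ
  simp only [gaussianDensity]
  set Z := ∫ z : V, Real.exp (-(τ * ‖z‖ ^ 2))
  have hsq : ‖x - (a + (b - c))‖ ^ 2 = ‖x - a‖ ^ 2 + ‖x - b‖ ^ 2 - ‖x - c‖ ^ 2 +
      (‖a - c‖ ^ 2 + ‖b - c‖ ^ 2 - ‖a - b‖ ^ 2) := by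
    rw [show x - (a + (b - c)) = (x - a) + ((x - b) - (x - c)) by abel,
      show a - c = (x - c) - (x - a) by abel, show b - c = (x - c) - (x - b) by abel,
      show a - b = (x - b) - (x - a) by abel]
    generalize x - a = u
    generalize x - c = v
    generalize x - b = w
    simp only [norm_sub_sq_real, norm_add_sq_real, inner_sub_right, real_inner_comm u v,
      real_inner_comm u w, real_inner_comm w v]
    ring
  rw [hsq, mul_div_assoc' (Real.exp _) (Real.exp _) Z, ← Real.exp_add,
    show Real.exp (τ * (‖a - c‖ ^ 2 + ‖b - c‖ ^ 2 - ‖a - b‖ ^ 2) + -(τ * (‖x - a‖ ^ 2 +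
      ‖x - b‖ ^ 2 - ‖x - c‖ ^ 2 + (‖a - c‖ ^ 2 + ‖b - c‖ ^ 2 - ‖a - b‖ ^ 2)))) =
      Real.exp (-(τ * ‖x - a‖ ^ 2)) * Real.exp (-(τ * ‖x - b‖ ^ 2)) /
        Real.exp (-(τ * ‖x - c‖ ^ 2)) by
    rw [← Real.exp_add, ← Real.exp_sub]; congr 1; ring]
  field_simp

/-- The `χ²`-type distance of two Gaussians relative to a third one. Its maximum over triples of
means with pairwise distances at most `D` is attained by an equilateral triangle. -/
lemma integratesTo_gaussianDensity_sub_sq_div (hτ : 0 < τ) {θ : ℝ} {a b c : V}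
    (hab : 2 * (τ * ‖a - b‖ ^ 2) ≤ θ) (hac : 2 * (τ * ‖a - c‖ ^ 2) ≤ θ)
    (hbc : 2 * (τ * ‖b - c‖ ^ 2) ≤ θ) :
    ∃ v ≤ 2 * Real.exp θ - 2 * Real.exp (θ / 2), IntegratesTo (fun x =>
      (gaussianDensity τ a x - gaussianDensity τ b x) ^ 2 / gaussianDensity τ c x) v := by
  have h := ((integratesTo_gaussianDensity_sq_div hτ a c).sub
    ((integratesTo_gaussianDensity_mul_div hτ a b c).const_mul 2)).add
    (integratesTo_gaussianDensity_sq_div hτ b c)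
  refine ⟨_, ?_, (?_ : IntegratesTo _ (Real.exp (2 * (τ * ‖a - c‖ ^ 2)) -
    2 * Real.exp (τ * (‖a - c‖ ^ 2 + ‖b - c‖ ^ 2 - ‖a - b‖ ^ 2)) +
      Real.exp (2 * (τ * ‖b - c‖ ^ 2))))⟩
  · set u := 2 * (τ * ‖a - c‖ ^ 2)
    set v := 2 * (τ * ‖b - c‖ ^ 2)
    have hinner : Real.exp ((u + v - θ) / 2) ≤
        Real.exp (τ * (‖a - c‖ ^ 2 + ‖b - c‖ ^ 2 - ‖a - b‖ ^ 2)) := by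
      apply Real.exp_le_exp.2
      simp only [u, v]
      linarith
    -- with `A = e^{u/2}`, `B = e^{v/2}`, `T = e^{θ/2}` the claim is
    -- `A² - 2AB/T + B² ≤ 2T² - 2T` for `0 ≤ A, B ≤ T`, `1 ≤ A, B`
    have hA : Real.exp (u / 2) ≤ Real.exp (θ / 2) := Real.exp_le_exp.2 (by linarith)
    have hB : Real.exp (v / 2) ≤ Real.exp (θ / 2) := Real.exp_le_exp.2 (by linarith)
    have hA1 : 1 ≤ Real.exp (u / 2) := Real.one_le_exp (by positivity)
    have hB1 : 1 ≤ Real.exp (v / 2) := Real.one_le_exp (by positivity)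
    have e1 : Real.exp u = Real.exp (u / 2) ^ 2 := by rw [← Real.exp_nat_mul]; congr 1; ring
    have e2 : Real.exp v = Real.exp (v / 2) ^ 2 := by rw [← Real.exp_nat_mul]; congr 1; ring
    have e3 : Real.exp θ = Real.exp (θ / 2) ^ 2 := by rw [← Real.exp_nat_mul]; congr 1; ring
    have e4 : Real.exp ((u + v - θ) / 2) =
        Real.exp (u / 2) * Real.exp (v / 2) / Real.exp (θ / 2) := by
      rw [← Real.exp_add, ← Real.exp_sub]; congr 1; ring
    rw [e4] at hinner
    rw [e1, e2, e3]
    have hT : 0 < Real.exp (θ / 2) := Real.exp_pos _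
    generalize Real.exp (u / 2) = A at *
    generalize Real.exp (v / 2) = B at *
    generalize Real.exp (θ / 2) = T at *
    have hkey : A ^ 2 - 2 * (A * B / T) + B ^ 2 ≤ 2 * T ^ 2 - 2 * T := by
      have hBT : B / T ≤ 1 := (div_le_one hT).2 hB
      have h1 : 0 ≤ (T - A) * (T + A - 2 * (B / T)) :=
        mul_nonneg (by linarith) (by linarith)
      have h2 : 0 ≤ (T - B) * (T + B - 2) := mul_nonneg (by linarith) (by linarith)
      have h3 : T * (B / T) = B := by field_simp
      have h4 : A * B / T = A * (B / T) := by ring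
      rw [h4]
      linear_combination h1 + h2 - 2 * h3
    linarith
  · convert h using 2 with x
    ring

/-- The order-`2` moment for one subsampled step: the data point in question is used with
probability `p`, and otherwise the step is Gaussian with mean `c` for both databases. -/
lemma lintegral_mixture_sq_div_le (hτ : 0 < τ) {θ p : ℝ} (hp0 : 0 ≤ p) (hp1 : p ≤ 1) {a b c : V}
    (hab : 2 * (τ * ‖a - b‖ ^ 2) ≤ θ) (hac : 2 * (τ * ‖a - c‖ ^ 2) ≤ θ)
    (hbc : 2 * (τ * ‖b - c‖ ^ 2) ≤ θ) :
    ∫⁻ x, ENNReal.ofReal (((1 - p) * gaussianDensity τ c x + p * gaussianDensity τ a x) ^ 2 /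
        ((1 - p) * gaussianDensity τ c x + p * gaussianDensity τ b x)) ≤
      ENNReal.ofReal (1 + p ^ 2 * (2 * Real.exp θ - 2 * Real.exp (θ / 2))) := by
  have ha := integratesTo_gaussianDensity hτ a
  have hb := integratesTo_gaussianDensity hτ b
  have hc := integratesTo_gaussianDensity hτ c
  have hθ : 0 ≤ θ := le_trans (by positivity) hab
  obtain ⟨v, hv, hv'⟩ := integratesTo_gaussianDensity_sub_sq_div hτ hab hac hbc
  obtain ⟨w, hw, hw'⟩ := integratesTo_gaussianDensity_sub_sq_div hτ hab hab
    (c := b) (by simpa using hθ)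
  have hp1' : 0 ≤ 1 - p := by linarith
  refine ((((hc.const_mul (1 - p)).add (hb.const_mul p)).add ((ha.sub hb).const_mul (2 * p))).add
    (((hv'.const_mul (1 - p)).add (hw'.const_mul p)).const_mul (p ^ 2))).lintegral_le ?_ ?_ ?_
  · intro x
    have := gaussianDensity_pos hτ a x
    have := gaussianDensity_pos hτ b x
    have := gaussianDensity_pos hτ c x
    positivity
  · intro x
    exact mixture_sq_div_le hp0 hp1 (gaussianDensity_pos hτ c x) (gaussianDensity_pos hτ b x)
  · have : (1 - p) * v + p * w ≤ 2 * Real.exp θ - 2 * Real.exp (θ / 2) := by nlinarith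
    have : p ^ 2 * ((1 - p) * v + p * w) ≤ p ^ 2 * (2 * Real.exp θ - 2 * Real.exp (θ / 2)) := by
      gcongr
    linarith

/-- The moment of order `k + 1` for one subsampled step. -/
lemma lintegral_mixture_pow_div_le (hτ : 0 < τ) (k : ℕ) {θ p : ℝ} (hp0 : 0 ≤ p) (hp1 : p ≤ 1)
    {a b c : V} (hab : 2 * (τ * ‖a - b‖ ^ 2) ≤ θ) (hac : 2 * (τ * ‖a - c‖ ^ 2) ≤ θ)
    (hbc : 2 * (τ * ‖b - c‖ ^ 2) ≤ θ) :
    ∫⁻ x, ENNReal.ofReal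
        (((1 - p) * gaussianDensity τ c x + p * gaussianDensity τ a x) ^ (k + 1) /
          ((1 - p) * gaussianDensity τ c x + p * gaussianDensity τ b x) ^ k) ≤
      ENNReal.ofReal (1 + p ^ 2 * (2 * (Real.exp (k * (k + 1) * θ / 2) - 1) +
        k * (k + 1) * (Real.exp θ - 1))) := by
  have ha := integratesTo_gaussianDensity hτ a
  have hb := integratesTo_gaussianDensity hτ b
  have hc := integratesTo_gaussianDensity hτ c
  have hp1' : 0 ≤ 1 - p := by linarith
  have hpow : ∀ {u v : V}, 2 * (τ * ‖u - v‖ ^ 2) ≤ θ →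
      Real.exp (k * (k + 1) * (τ * ‖u - v‖ ^ 2)) ≤ Real.exp (k * (k + 1) * θ / 2) :=
    fun {u v} h => Real.exp_le_exp.2 (by
      have hk : (0 : ℝ) ≤ k * (k + 1) := by positivity
      nlinarith)
  have hac' := integratesTo_gaussianDensity_pow_div hτ k a c
  have hab' := integratesTo_gaussianDensity_pow_div hτ k a b
  have hba := integratesTo_gaussianDensity_sq_div hτ b a
  have hbc' := integratesTo_gaussianDensity_sq_div hτ b c
  refine ((((hc.const_mul (1 - p)).add (hb.const_mul p)).add
      ((ha.sub hb).const_mul ((k + 1) * p))).add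
    (((((hac'.sub hc).sub ((ha.sub hc).const_mul (k + 1))).add
      ((hab'.sub hb).sub ((ha.sub hb).const_mul (k + 1)))).add
      ((((hba.sub (hb.const_mul 2)).add ha).add
        ((hbc'.sub (hb.const_mul 2)).add hc)).const_mul (k * (k + 1) / 2))).const_mul
          (p ^ 2))).lintegral_le ?_ ?_ ?_
  · intro x
    have := gaussianDensity_pos hτ a x
    have := gaussianDensity_pos hτ b x
    have := gaussianDensity_pos hτ c x
    positivity
  · intro x
    exact mixture_pow_div_le hp0 hp1 (gaussianDensity_pos hτ c x) (gaussianDensity_pos hτ a x)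
      (gaussianDensity_pos hτ b x)
  · have h1 := hpow hac
    have h2 := hpow hab
    have h3 : Real.exp (2 * (τ * ‖b - a‖ ^ 2)) ≤ Real.exp θ :=
      Real.exp_le_exp.2 (by rwa [norm_sub_rev])
    have h4 : Real.exp (2 * (τ * ‖b - c‖ ^ 2)) ≤ Real.exp θ := Real.exp_le_exp.2 hbc
    generalize Real.exp (k * (k + 1) * (τ * ‖a - c‖ ^ 2)) = A1 at *
    generalize Real.exp (k * (k + 1) * (τ * ‖a - b‖ ^ 2)) = A2 at *
    generalize Real.exp (2 * (τ * ‖b - a‖ ^ 2)) = A3 at *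
    generalize Real.exp (2 * (τ * ‖b - c‖ ^ 2)) = A4 at *
    generalize Real.exp (k * (k + 1) * θ / 2) = T at *
    generalize Real.exp θ = T' at *
    have hk : (0 : ℝ) ≤ k * (k + 1) / 2 := by positivity
    have h5 : k * (k + 1) / 2 * (A3 + A4) ≤ k * (k + 1) / 2 * (2 * T') := by
      gcongr
      linarith
    have h6 : p ^ 2 * (A1 + A2 - 2 + k * (k + 1) / 2 * (A3 + A4 - 2)) ≤
        p ^ 2 * (2 * (T - 1) + k * (k + 1) * (T' - 1)) := by
      gcongr p ^ 2 * ?_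
      linarith
    linarith

end GaussianDensity

lemma uniformOn_univ_bind {Y : Type*} [MeasurableSpace Y] {n : ℕ} (κ : Fin n → Measure Y) :
    (uniformOn (Set.univ : Set (Fin n))).bind κ = ∑ i, (n : ℝ≥0∞)⁻¹ • κ i := by
  ext s hs
  rw [Measure.bind_apply hs (measurable_of_finite κ).aemeasurable, uniformOn, ProbabilityTheory.cond,
    Measure.restrict_univ, lintegral_smul_measure, lintegral_count, tsum_fintype,
    Measure.count_univ, ENat.card_eq_coe_fintype_card, Fintype.card_fin]
  simp [Finset.mul_sum]

section Noise

variable {V : Type*} [NormedAddCommGroup V] [InnerProductSpace ℝ V] [FiniteDimensional ℝ V]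
  [MeasurableSpace V] [BorelSpace V]

/-- The isotropic Gaussian distribution with mean `a` and precision `2 * τ`. -/
noncomputable def gaussianLaw (τ : ℝ) (a : V) : Measure V :=
  volume.withDensity fun x => ENNReal.ofReal (gaussianDensity τ a x)

lemma map_add_left_gaussianLaw (τ : ℝ) (a : V) :
    (gaussianLaw τ (0 : V)).map (fun z => a + z) = gaussianLaw τ a := by
  ext s hs
  have hT : Measurable fun z : V => a + z := by fun_prop
  rw [gaussianLaw, gaussianLaw, Measure.map_apply hT hs, withDensity_apply _ (hT hs),
    withDensity_apply _ hs, ← lintegral_indicator (hT hs), ← lintegral_indicator hs,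
    ← lintegral_add_left_eq_self (s.indicator _) a]
  refine lintegral_congr fun x => ?_
  simp only [Set.indicator, gaussianDensity, sub_zero, add_sub_cancel_left]
  rfl

/-- Grouping a uniform mixture around one index `i₀`: draw another index `j` first, and then choose
`i₀` with probability `1 / n` and `j` otherwise. -/
lemma sum_gaussianLaw_eq {τ : ℝ} (hτ : 0 < τ) {n : ℕ} (hn : 2 ≤ n) (g : Fin n → V) (i₀ : Fin n) :
    ∑ i, (n : ℝ≥0∞)⁻¹ • gaussianLaw τ (g i) =
      ∑ j ∈ Finset.univ.erase i₀, ENNReal.ofReal (1 / (n - 1)) •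
        volume.withDensity fun x => ENNReal.ofReal
          ((1 - 1 / n) * gaussianDensity τ (g j) x + 1 / n * gaussianDensity τ (g i₀) x) := by
  have hn' : (2 : ℝ) ≤ n := by exact_mod_cast hn
  have hn1 : (0 : ℝ) < n - 1 := by linarith
  have hp : (0 : ℝ) ≤ 1 - 1 / n := by
    rw [sub_nonneg, div_le_one (by linarith)]; linarith
  have hmix : ∀ j, (volume.withDensity fun x => ENNReal.ofReal
      ((1 - 1 / n) * gaussianDensity τ (g j) x + 1 / n * gaussianDensity τ (g i₀) x)) =
      ENNReal.ofReal (1 - 1 / n) • gaussianLaw τ (g j) +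
        ENNReal.ofReal (1 / n) • gaussianLaw τ (g i₀) := by
    intro j
    rw [gaussianLaw, gaussianLaw, ← withDensity_smul _ (measurable_gaussianDensity _).ennreal_ofReal,
      ← withDensity_smul _ (measurable_gaussianDensity _).ennreal_ofReal,
      ← withDensity_add_left (by exact (measurable_gaussianDensity _).ennreal_ofReal.const_mul _)]
    congr 1
    funext x
    have h1 := (gaussianDensity_pos hτ (g j) x).le
    have h2 := (gaussianDensity_pos hτ (g i₀) x).le
    simp only [Pi.add_apply, Pi.smul_apply, smul_eq_mul]
    rw [ENNReal.ofReal_add (by positivity) (by positivity), ENNReal.ofReal_mul hp,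
      ENNReal.ofReal_mul (by positivity)]
  have hinv : (n : ℝ≥0∞)⁻¹ = ENNReal.ofReal (1 / n) := by
    rw [one_div, ENNReal.ofReal_inv_of_pos (by linarith), ENNReal.ofReal_natCast]
  have hcoef : ENNReal.ofReal (1 / (n - 1)) * ENNReal.ofReal (1 - 1 / n) =
      ENNReal.ofReal (1 / n) := by
    rw [← ENNReal.ofReal_mul (by positivity)]
    congr 1
    field_simp
  have hcount : ((n - 1 : ℕ) : ℝ≥0∞) * ENNReal.ofReal (1 / (n - 1)) = 1 := by
    rw [← ENNReal.ofReal_natCast, ← ENNReal.ofReal_mul (by positivity), Nat.cast_sub (by omega),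
      Nat.cast_one, mul_one_div_cancel hn1.ne', ENNReal.ofReal_one]
  simp_rw [hmix, smul_add, smul_smul, hcoef, hinv]
  rw [Finset.sum_add_distrib, Finset.sum_const, Finset.card_erase_of_mem (Finset.mem_univ _),
    Finset.card_univ, Fintype.card_fin, ← Nat.cast_smul_eq_nsmul ℝ≥0∞, smul_smul, ← mul_assoc,
    hcount, one_mul, Finset.sum_erase_add _ _ (Finset.mem_univ _)]

end Noise


/-! ### Rounds of the algorithm -/

section PrivateSGD

variable {X : Type*} {d n : ℕ} {f : EuclideanSpace ℝ (Fin d) → X → ℝ} {τ : ℝ}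

lemma gradientNoise_eq_gaussianLaw {L ε δ : ℝ}
    (hτ : 0 < ε ^ 2 / (8 * L ^ 2 * Real.log (3 * n / δ) * Real.log (2 / δ))) :
    gradientNoise d n L ε δ =
      gaussianLaw (ε ^ 2 / (8 * L ^ 2 * Real.log (3 * n / δ) * Real.log (2 / δ))) 0 := by
  have hZ := integral_exp_neg_mul_sq_norm_pos (V := EuclideanSpace ℝ (Fin d)) hτ
  have hint := integrable_exp_neg_mul_sq_norm' (V := EuclideanSpace ℝ (Fin d)) hτ
  rw [gradientNoise, densityProportionalTo, gaussianLaw]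
  simp_rw [mul_div_right_comm (ε ^ 2)]
  set τ := ε ^ 2 / (8 * L ^ 2 * Real.log (3 * n / δ) * Real.log (2 / δ))
  rw [withDensity_apply _ MeasurableSet.univ, Measure.restrict_univ,
    ← ofReal_integral_eq_lintegral_ofReal hint (ae_of_all _ fun x => (Real.exp_pos _).le),
    ← withDensity_smul _ (by fun_prop)]
  congr 1
  funext x
  simp only [Pi.smul_apply, smul_eq_mul, gaussianDensity, sub_zero]
  rw [div_eq_inv_mul, ENNReal.ofReal_mul (inv_pos.2 hZ).le, ENNReal.ofReal_inv_of_pos hZ]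

lemma isProbabilityMeasure_gaussianLaw (hτ : 0 < τ) (a : EuclideanSpace ℝ (Fin d)) :
    IsProbabilityMeasure (gaussianLaw τ a) := by
  have h := integratesTo_gaussianDensity hτ a
  refine ⟨?_⟩
  rw [gaussianLaw, withDensity_apply _ MeasurableSet.univ, Measure.restrict_univ,
    ← ofReal_integral_eq_lintegral_ofReal h.1 (ae_of_all _ fun x => (gaussianDensity_pos hτ a x).le),
    h.2, ENNReal.ofReal_one]

/-- One round is a fixed affine image of a uniform mixture of Gaussians centered at the
gradients. -/
lemma noisySGDStep_gaussianLaw_eq_map (S : Fin n → X) (η : ℝ) (w : EuclideanSpace ℝ (Fin d)) :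
    noisySGDStep f (gaussianLaw τ 0) S η w =
      (∑ i, (n : ℝ≥0∞)⁻¹ • gaussianLaw τ (gradient (fun u => f u (S i)) w)).map
        fun y => w - η • y := by
  have hT : Measurable fun y : EuclideanSpace ℝ (Fin d) => w - η • y := by fun_prop
  rw [noisySGDStep, uniformOn_univ_bind, Measure.map_finset_sum hT.aemeasurable]
  refine Finset.sum_congr rfl fun i _ => ?_
  rw [Measure.map_smul, ← map_add_left_gaussianLaw τ (gradient _ _), Measure.map_map hT (by fun_prop)]
  rfl

lemma measurable_noisySGDStep (ν : Measure (EuclideanSpace ℝ (Fin d))) [SFinite ν] (S : Fin n → X) (η : ℝ) :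
    Measurable (noisySGDStep f ν S η) := by
  have hgrad : ∀ i, Measurable fun w => gradient (fun u => f u (S i)) w := fun i => by
    unfold gradient
    exact (InnerProductSpace.toDual ℝ _).symm.continuous.measurable.comp (measurable_fderiv ℝ _)
  refine Measure.measurable_of_measurable_coe _ fun s hs => ?_
  simp only [noisySGDStep, uniformOn_univ_bind, Measure.finsetSum_apply, Measure.smul_apply,
    smul_eq_mul]
  refine Finset.measurable_sum _ fun i _ => Measurable.const_mul ?_ _
  have hT : Measurable fun q : EuclideanSpace ℝ (Fin d) × EuclideanSpace ℝ (Fin d) =>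
      q.1 - η • (gradient (fun u => f u (S i)) q.1 + q.2) := by
    have : Measurable fun q : EuclideanSpace ℝ (Fin d) × EuclideanSpace ℝ (Fin d) =>
        gradient (fun u => f u (S i)) q.1 := (hgrad i).comp measurable_fst
    exact measurable_fst.sub ((this.add measurable_snd).const_smul η)
  have := measurable_measure_prodMk_left (ν := ν) (hT hs)
  convert this using 2 with w
  rw [Measure.map_apply (by fun_prop) hs]
  rfl

lemma isProbabilityMeasure_noisySGDStep (hn : 1 ≤ n) (ν : Measure (EuclideanSpace ℝ (Fin d)))
    [IsProbabilityMeasure ν] (S : Fin n → X) (η : ℝ) (w : EuclideanSpace ℝ (Fin d)) :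
    IsProbabilityMeasure (noisySGDStep f ν S η w) := by
  refine ⟨?_⟩
  have : ∀ i, (ν.map fun z => w - η • (gradient (fun u => f u (S i)) w + z)) Set.univ = 1 :=
    fun i => by
      rw [Measure.map_apply (by fun_prop) MeasurableSet.univ, Set.preimage_univ, measure_univ]
  simp only [noisySGDStep, uniformOn_univ_bind, Measure.finsetSum_apply, Measure.smul_apply,
    smul_eq_mul, this, mul_one, Finset.sum_const, Finset.card_univ, Fintype.card_fin, nsmul_eq_mul]
  exact ENNReal.mul_inv_cancel (by simp; omega) (by simp)

lemma isProbabilityMeasure_noisySGDIterate (hn : 1 ≤ n) (ν : Measure (EuclideanSpace ℝ (Fin d)))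
    [IsProbabilityMeasure ν] (η : ℕ → ℝ) (w₀ : EuclideanSpace ℝ (Fin d)) (S : Fin n → X) (t : ℕ) :
    IsProbabilityMeasure (noisySGDIterate f ν η w₀ S t) := by
  induction t with
  | zero => exact Measure.dirac.isProbabilityMeasure
  | succ t ih =>
    exact isProbabilityMeasure_bind (measurable_noisySGDStep ν S _).aemeasurable
      (ae_of_all _ fun w => isProbabilityMeasure_noisySGDStep hn ν S _ w)

lemma norm_gradient_le_of_lipschitzWith {L : NNReal} {g : EuclideanSpace ℝ (Fin d) → ℝ}
    (hg : LipschitzWith L g) (w : EuclideanSpace ℝ (Fin d)) : ‖gradient g w‖ ≤ L := by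
  rw [gradient, LinearIsometryEquiv.norm_map]
  exact norm_fderiv_le_of_lipschitz ℝ hg

/-- A moment bound for subsampled steps with three gradients of norm at most `L` yields one for a
round of the algorithm on neighboring databases. -/
lemma densityMomentLE_noisySGDStep {k : ℕ} (hk : 1 ≤ k) (hn : 2 ≤ n) (hτ : 0 < τ) {L : NNReal}
    (hlip : ∀ x, LipschitzWith L fun w => f w x) {B : ℝ≥0∞}
    (hB : ∀ a b c : EuclideanSpace ℝ (Fin d), ‖a‖ ≤ L → ‖b‖ ≤ L → ‖c‖ ≤ L →
      ∫⁻ x, ENNReal.ofReal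
        (((1 - 1 / n) * gaussianDensity τ c x + 1 / n * gaussianDensity τ a x) ^ (k + 1) /
          ((1 - 1 / n) * gaussianDensity τ c x + 1 / n * gaussianDensity τ b x) ^ k) ≤ B)
    {S S' : Fin n → X} (hS : Neighboring S S') (η : ℝ) (w : EuclideanSpace ℝ (Fin d)) :
    DensityMomentLE k B (noisySGDStep f (gaussianLaw τ 0) S η w)
      (noisySGDStep f (gaussianLaw τ 0) S' η w) := by
  obtain ⟨i₀, -, hS⟩ := hS
  have hn' : (2 : ℝ) ≤ n := by exact_mod_cast hn
  have hn1 : (0 : ℝ) < n - 1 := by linarith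
  have hp : (0 : ℝ) ≤ 1 - 1 / n := by
    rw [sub_nonneg, div_le_one (by linarith)]; linarith
  rw [noisySGDStep_gaussianLaw_eq_map, noisySGDStep_gaussianLaw_eq_map]
  refine DensityMomentLE.map ?_ (by fun_prop)
  rw [sum_gaussianLaw_eq hτ hn _ i₀, sum_gaussianLaw_eq hτ hn _ i₀]
  refine DensityMomentLE.sum_smul hk _ _ ?_ fun j hj => ?_
  · rw [Finset.sum_const, Finset.card_erase_of_mem (Finset.mem_univ _), Finset.card_univ,
      Fintype.card_fin, nsmul_eq_mul, ← ENNReal.ofReal_natCast, ← ENNReal.ofReal_mul (by positivity),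
      Nat.cast_sub (by omega), Nat.cast_one, mul_one_div_cancel hn1.ne', ENNReal.ofReal_one]
  · have hpos : ∀ a c x : EuclideanSpace ℝ (Fin d),
        0 < (1 - 1 / (n : ℝ)) * gaussianDensity τ c x + 1 / n * gaussianDensity τ a x := by
      intro a c x
      have h1 := gaussianDensity_pos hτ a x
      have h2 := gaussianDensity_pos hτ c x
      positivity
    have hmeas : ∀ a c : EuclideanSpace ℝ (Fin d), Measurable fun x =>
        (1 - 1 / (n : ℝ)) * gaussianDensity τ c x + 1 / n * gaussianDensity τ a x := fun a c =>
      ((measurable_gaussianDensity c).const_mul _).add ((measurable_gaussianDensity a).const_mul _)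
    rw [hS j (Finset.ne_of_mem_erase hj)]
    exact DensityMomentLE.of_density hk (hmeas _ _) (hmeas _ _) (hpos _ _) (hpos _ _)
      (hB _ _ _ (norm_gradient_le_of_lipschitzWith (hlip _) w)
        (norm_gradient_le_of_lipschitzWith (hlip _) w)
        (norm_gradient_le_of_lipschitzWith (hlip _) w))

/-- With a single data point there is no subsampling, and a round compares two Gaussians. -/
lemma densityMomentLE_noisySGDStep_one {k : ℕ} (hk : 1 ≤ k) (hτ : 0 < τ) {L : NNReal}
    (hlip : ∀ x, LipschitzWith L fun w => f w x) {B : ℝ≥0∞}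
    (hB : ∀ a b : EuclideanSpace ℝ (Fin d), ‖a‖ ≤ L → ‖b‖ ≤ L →
      ∫⁻ x, ENNReal.ofReal (gaussianDensity τ a x ^ (k + 1) / gaussianDensity τ b x ^ k) ≤ B)
    (S S' : Fin 1 → X) (η : ℝ) (w : EuclideanSpace ℝ (Fin d)) :
    DensityMomentLE k B (noisySGDStep f (gaussianLaw τ 0) S η w)
      (noisySGDStep f (gaussianLaw τ 0) S' η w) := by
  rw [noisySGDStep_gaussianLaw_eq_map, noisySGDStep_gaussianLaw_eq_map]
  refine DensityMomentLE.map ?_ (by fun_prop)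
  simp only [Finset.univ_unique, Finset.sum_singleton, Nat.cast_one, inv_one, one_smul]
  exact DensityMomentLE.of_density hk (measurable_gaussianDensity _) (measurable_gaussianDensity _)
    (gaussianDensity_pos hτ _) (gaussianDensity_pos hτ _)
    (hB _ _ (norm_gradient_le_of_lipschitzWith (hlip _) w)
      (norm_gradient_le_of_lipschitzWith (hlip _) w))

lemma densityMomentLE_noisySGDIterate {k : ℕ} (hk : 1 ≤ k)
    {ν : Measure (EuclideanSpace ℝ (Fin d))}
    [SFinite ν] {S S' : Fin n → X} {B : ℝ≥0∞}
    (h : ∀ η w, DensityMomentLE k B (noisySGDStep f ν S η w) (noisySGDStep f ν S' η w))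
    (η : ℕ → ℝ) (w₀ : EuclideanSpace ℝ (Fin d)) (t : ℕ) :
    DensityMomentLE k (B ^ t) (noisySGDIterate f ν η w₀ S t) (noisySGDIterate f ν η w₀ S' t) := by
  induction t with
  | zero =>
    rw [pow_zero]
    exact DensityMomentLE.dirac hk w₀
  | succ t ih =>
    rw [pow_succ]
    exact ih.bind hk (measurable_noisySGDStep ν S _) (measurable_noisySGDStep ν S' _) (h _)

/-- A moment bound `b` per round, compounded over at most `n ^ 2` rounds, gives privacy of each
iterate. -/
lemma measure_noisySGDIterate_le (hn : 1 ≤ n) {k : ℕ} (hk : 1 ≤ k) {b ε δ : ℝ} (hb : 1 ≤ b)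
    {ν : Measure (EuclideanSpace ℝ (Fin d))} [IsProbabilityMeasure ν] {S S' : Fin n → X}
    (h : ∀ η w, DensityMomentLE k (ENNReal.ofReal b) (noisySGDStep f ν S η w)
      (noisySGDStep f ν S' η w))
    (hbound : b ^ n ^ 2 ≤ 2 * (k + 1) * δ * Real.exp (k * ε)) (η : ℕ → ℝ)
    (w₀ : EuclideanSpace ℝ (Fin d)) {t : ℕ} (ht : t ≤ n ^ 2) {A : Set (EuclideanSpace ℝ (Fin d))}
    (hA : MeasurableSet A) :
    noisySGDIterate f ν η w₀ S t A ≤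
      ENNReal.ofReal (Real.exp ε) * noisySGDIterate f ν η w₀ S' t A + ENNReal.ofReal δ := by
  have := isProbabilityMeasure_noisySGDIterate (f := f) hn ν η w₀ S' t
  have hmom := densityMomentLE_noisySGDIterate hk h η w₀ t
  rw [← ENNReal.ofReal_pow (by linarith)] at hmom
  exact hmom.measure_le hk (by positivity) ((pow_le_pow_right₀ hb ht).trans hbound) hA

/-- The number of rounds does not depend on the data, so that privacy of every iterate that can be
the output gives privacy of the output. -/
lemma measure_bind_le {Y : Type*} [MeasurableSpace Y] (P : PMF ℕ) {κ κ' : ℕ → Measure Y}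
    {c e : ℝ≥0∞} {A : Set Y} (hA : MeasurableSet A)
    (h : ∀ t ∈ P.support, κ t A ≤ c * κ' t A + e) :
    P.toMeasure.bind κ A ≤ c * P.toMeasure.bind κ' A + e := by
  rw [Measure.bind_apply hA (measurable_of_countable κ).aemeasurable,
    Measure.bind_apply hA (measurable_of_countable κ').aemeasurable]
  have hae : ∀ᵐ t ∂P.toMeasure, κ t A ≤ c * κ' t A + e := by
    rw [ae_iff]
    rw [PMF.toMeasure_apply_eq_zero_iff _ (Set.to_countable _).measurableSet]
    rw [Set.disjoint_left]
    exact fun t ht hneg => hneg (h t ht)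
  refine (lintegral_mono_ae hae).trans_eq ?_
  rw [lintegral_add_right _ measurable_const, lintegral_const_mul _ (measurable_of_countable _),
    lintegral_const, measure_univ, mul_one]

end PrivateSGD

/-! ### Choice of the order -/

lemma exp_le_cubic {x : ℝ} (h0 : 0 ≤ x) (h1 : x ≤ 1) :
    Real.exp x ≤ 1 + x + x ^ 2 / 2 + x ^ 3 * (2 / 9) := by
  have h := Real.exp_bound' h0 h1 (n := 3) (by norm_num)
  norm_num [Finset.sum_range_succ, Nat.factorial] at h
  linarith

lemma log_three_gt : (1.09 : ℝ) < Real.log 3 := by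
  have he : (0 : ℝ) < Real.exp 1 := Real.exp_pos 1
  have h := Real.one_sub_inv_le_log_of_pos (x := 3 / Real.exp 1) (by positivity)
  rw [Real.log_div (by norm_num) he.ne', Real.log_exp, inv_div] at h
  have := Real.exp_one_lt_d9
  linarith

lemma log_four_mul_succ_ge {k : ℕ} : 2.4 + (1 - 3 / (k + 1)) ≤ Real.log (4 * (k + 1)) := by
  have h := Real.one_sub_inv_le_log_of_pos (x := ((k : ℝ) + 1) / 3) (by positivity)
  have h12 : Real.log 12 = 2 * Real.log 2 + Real.log 3 := by
    rw [show (12 : ℝ) = 2 ^ 2 * 3 by norm_num, Real.log_mul (by norm_num) (by norm_num),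
      Real.log_pow]
    norm_num
  have := Real.log_two_gt_d9
  have := log_three_gt
  rw [show 4 * ((k : ℝ) + 1) = 12 * ((k + 1) / 3) by ring,
    Real.log_mul (by norm_num) (by positivity), h12]
  rw [inv_div] at h
  linarith

lemma log_eight_gt : (2.079 : ℝ) < Real.log 8 := by
  rw [show (8 : ℝ) = 2 ^ 3 by norm_num, Real.log_pow]
  have := Real.log_two_gt_d9
  push_cast
  linarith

/-- The privacy budget left by the order-`2` moment, used when `ε` is not small compared with
`l = log (2 / δ)`. -/
lemma chiSq_budget {l m ε : ℝ} (hl : Real.log 2 ≤ l) (hm : l + 1 ≤ m) (hε : 0 < ε) (hε1 : ε ≤ 1)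
    (hlε : l ≤ 2 * ε) :
    2 * Real.exp (ε ^ 2 / (l * m)) - 2 * Real.exp (ε ^ 2 / (l * m) / 2) + l - ε ≤ Real.log 8 := by
  have hl0 := Real.log_two_gt_d9
  have h8 := log_eight_gt
  have hl1 : 0.693 ≤ l := by linarith
  set θ := ε ^ 2 / (l * m) with hθ
  have hθl : θ * (1.69 * l) ≤ ε := by
    have : θ * (l * m) = ε ^ 2 := by
      rw [hθ]
      exact div_mul_cancel₀ _ (by nlinarith)
    have hθ0 : 0 ≤ θ := div_nonneg (by positivity) (by nlinarith)
    have : θ * (1.69 * l) ≤ θ * (l * m) := by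
      apply mul_le_mul_of_nonneg_left _ hθ0
      nlinarith
    nlinarith
  have hθ0 : 0 ≤ θ := div_nonneg (by positivity) (by nlinarith)
  have hθ1 : θ ≤ 0.86 := by nlinarith
  have hs := exp_le_cubic (x := θ / 2) (by linarith) (by linarith)
  have hexp : Real.exp θ = Real.exp (θ / 2) ^ 2 := by rw [← Real.exp_nat_mul]; congr 1; ring
  have hs2 : Real.exp (θ / 2) ≤ 1 + 1.3 * (θ / 2) := by nlinarith [sq_nonneg θ]
  have hs1 : 1 ≤ Real.exp (θ / 2) := Real.one_le_exp (by linarith)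
  have hmain : 2 * Real.exp θ - 2 * Real.exp (θ / 2) ≤ 2.35 * θ := by
    rw [hexp]
    generalize Real.exp (θ / 2) = T at *
    nlinarith
  rcases le_total 1.4 l with h | h
  · nlinarith
  · have hθl' : θ * l ≤ 0.592 * ε := by linarith
    have : 2.35 * θ * l ≤ 1.4 * ε := by nlinarith
    -- multiply the claim by `l`
    have : (2.35 * θ + l - ε) * l ≤ 2.079 * l := by nlinarith
    have := le_of_mul_le_mul_right this (by linarith)
    linarith

/-- The privacy budget left by the moment of order `k + 1` when `k = ⌊log (2 / δ) / ε⌋`. -/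
lemma moment_budget {k : ℕ} (hk : 2 ≤ k) {l m ε : ℝ} (hm : l + 1 ≤ m) (hε : 0 < ε)
    (hε1 : ε ≤ 1) (hkl : k * ε ≤ l) (hlk : l ≤ (k + 1) * ε) :
    2 * (Real.exp (k * (k + 1) * (ε ^ 2 / (l * m)) / 2) - 1) +
      k * (k + 1) * (Real.exp (ε ^ 2 / (l * m)) - 1) + l - k * ε ≤ Real.log (4 * (k + 1)) := by
  have hk' : (2 : ℝ) ≤ k := by exact_mod_cast hk
  have hl : 0 < l := by nlinarith
  set θ := ε ^ 2 / (l * m) with hθ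
  have hθ0 : 0 ≤ θ := div_nonneg (by positivity) (by nlinarith)
  -- `s` is the fractional part of `log (2 / δ) / ε`
  obtain ⟨s, rfl⟩ : ∃ s, l = (k + s) * ε := ⟨l / ε - k, by field_simp; ring⟩
  have hs0 : 0 ≤ s := by
    by_contra h
    nlinarith
  have hs1 : s ≤ 1 := by
    by_contra h
    nlinarith
  have hθle : θ ≤ 1 / ((k + s) * (k + s + 1)) := by
    rw [hθ, div_le_div_iff₀ (by nlinarith) (by positivity), one_mul]
    have : (k + s + 1) * ε ≤ m := by nlinarith
    calc ε ^ 2 * ((k + s) * (k + s + 1)) = (k + s) * ε * ((k + s + 1) * ε) := by ring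
      _ ≤ (k + s) * ε * m := by gcongr
  have hθ6 : θ ≤ 1 / 6 := hθle.trans (by
    rw [div_le_div_iff₀ (by positivity) (by norm_num)]
    nlinarith)
  set y := k * (k + 1) * θ / 2 with hy
  have hy0 : 0 ≤ y := by positivity
  -- the chord of the convex function `s ↦ k (k + 1) / ((k + s) (k + s + 1))` on `[0, 1]`
  have hyle : 2 * y ≤ 1 - 2 * s / (k + 2) := by
    calc 2 * y = k * (k + 1) * θ := by rw [hy]; ring
      _ ≤ k * (k + 1) * (1 / ((k + s) * (k + s + 1))) := by gcongr
      _ ≤ 1 - 2 * s / (k + 2) := by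
        rw [one_sub_div (by positivity), mul_one_div, div_le_div_iff₀ (by positivity)
          (by positivity)]
        have : 0 ≤ s * ((3 * k + 2) - 3 * k * s - 2 * s ^ 2) := by
          apply mul_nonneg hs0
          nlinarith
        linarith
  have hy2 : y ≤ 1 / 2 := by
    have : 0 ≤ 2 * s / (k + 2) := by positivity
    linarith
  have hey : Real.exp y - 1 ≤ 1.306 * y := by
    have := exp_le_cubic hy0 (by linarith)
    nlinarith [mul_nonneg hy0 (sub_nonneg.2 hy2), sq_nonneg y]
  have heθ : Real.exp θ - 1 ≤ 1.09 * θ := by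
    have := exp_le_cubic hθ0 (by linarith)
    nlinarith [mul_nonneg hθ0 (sub_nonneg.2 hθ6), sq_nonneg θ]
  have heθ' : k * (k + 1) * (Real.exp θ - 1) ≤ 2.18 * y := by
    calc k * (k + 1) * (Real.exp θ - 1) ≤ k * (k + 1) * (1.09 * θ) := by gcongr
      _ = 2.18 * y := by rw [hy]; ring
  have hrest : (k + s) * ε - k * ε ≤ s := by nlinarith
  refine le_trans ?_ (log_four_mul_succ_ge (k := k))
  have h1 : 3 / ((k : ℝ) + 1) ≤ 1 := by rw [div_le_one (by positivity)]; linarith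
  have h2 : 3 / ((k : ℝ) + 1) ≤ 4.8 / (k + 2) := by
    rw [div_le_div_iff₀ (by positivity) (by positivity)]; linarith
  have h3 : 2.4 * (2 * s / (k + 2)) = s * (4.8 / (k + 2)) := by ring
  nlinarith

/-- The privacy budget left by the moment of order `k + 1` for a single data point. -/
lemma gaussian_budget {k : ℕ} (hk : 1 ≤ k) {l m ε : ℝ} (hl : Real.log 2 ≤ l) (hm : l + 1 / 3 ≤ m)
    (hε : 0 < ε) (hε1 : ε ≤ 1) (hkl : k * ε ≤ l ∨ k = 1 ∧ l ≤ ε) (hlk : l ≤ (k + 1) * ε) :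
    k * (k + 1) * (ε ^ 2 / (l * m)) / 2 + l - k * ε ≤ Real.log (4 * (k + 1)) := by
  have hk' : (1 : ℝ) ≤ k := by exact_mod_cast hk
  have hl0 := Real.log_two_gt_d9
  have h8 : (2.079 : ℝ) ≤ Real.log (4 * (k + 1)) :=
    log_eight_gt.le.trans (Real.log_le_log (by norm_num) (by linarith))
  refine le_trans ?_ h8
  have hl1 : 0.693 ≤ l := by linarith
  have hlm : 0 < l * m := by nlinarith
  rcases hkl with h | ⟨rfl, h⟩
  · have : k * (k + 1) * (ε ^ 2 / (l * m)) / 2 ≤ 1 := by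
      rw [← mul_div_assoc, div_div, div_le_one (by positivity)]
      nlinarith
    nlinarith
  · rw [Nat.cast_one, one_mul, one_mul]
    have : (1 + 1) * (ε ^ 2 / (l * m)) / 2 ≤ 2 := by
      rw [← mul_div_assoc, div_div, div_le_iff₀ (by positivity)]
      nlinarith
    linarith

lemma one_add_div_pow_le_exp {n : ℕ} {K : ℝ} (hn : 1 ≤ n) (hK : 0 ≤ K) :
    (1 + (1 / (n : ℝ)) ^ 2 * K) ^ n ^ 2 ≤ Real.exp K := by
  have hn' : (0 : ℝ) < n := by exact_mod_cast hn
  calc (1 + (1 / (n : ℝ)) ^ 2 * K) ^ n ^ 2 ≤ Real.exp ((1 / (n : ℝ)) ^ 2 * K) ^ n ^ 2 := by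
        gcongr
        linarith [Real.add_one_le_exp ((1 / (n : ℝ)) ^ 2 * K)]
    _ = Real.exp K := by
        rw [← Real.exp_nat_mul]
        congr 1
        push_cast
        field_simp

lemma exp_le_of_add_log_le_log {k : ℕ} {K ε δ : ℝ} (hδ : 0 < δ)
    (h : K + Real.log (2 / δ) - k * ε ≤ Real.log (4 * (k + 1))) :
    Real.exp K ≤ 2 * (k + 1) * δ * Real.exp (k * ε) := by
  have h1 : Real.exp K ≤
      Real.exp (Real.log (4 * (k + 1)) - Real.log (2 / δ) + k * ε) :=
    Real.exp_le_exp.2 (by linarith)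
  rw [Real.exp_add, Real.exp_sub, Real.exp_log (by positivity), Real.exp_log (by positivity)] at h1
  refine h1.trans_eq ?_
  field_simp
  ring

/-! ### Privacy -/

theorem mainTheorem4 {X : Type*} (d n : ℕ) (hn : 1 ≤ n)
    (f : EuclideanSpace ℝ (Fin d) → X → ℝ) (L : NNReal) (hL : 0 < L)
    (hf_diff : ∀ x, Differentiable ℝ fun w => f w x)
    (hf_lip : ∀ x, LipschitzWith L fun w => f w x)
    (ε δ : ℝ) (hε : ε ∈ Set.Ioc (0 : ℝ) 1) (hδ : δ ∈ Set.Ioo (0 : ℝ) 1)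
    (P : PMF ℕ) (hP : P.support ⊆ Set.Icc 1 (n ^ 2))
    (η : ℕ → ℝ) (w₀ : EuclideanSpace ℝ (Fin d)) :
    IsDifferentiallyPrivate
      (fun S : Fin n → X => randomRoundPrivateSGD f L ε δ P η w₀ S) ε δ := by
  obtain ⟨hε0, hε1⟩ := hε
  obtain ⟨hδ0, hδ1⟩ := hδ
  have hn' : (1 : ℝ) ≤ n := by exact_mod_cast hn
  have hL' : (0 : ℝ) < L := by exact_mod_cast hL
  set l := Real.log (2 / δ) with hl
  set m := Real.log (3 * n / δ) with hm
  have hl2 : Real.log 2 ≤ l :=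
    Real.log_le_log (by norm_num) (by rw [le_div_iff₀ hδ0]; linarith)
  have hl0 : 0 < l := (Real.log_pos (by norm_num)).trans_le hl2
  have hml : m = l + Real.log (3 * n / 2) := by
    rw [hm, hl, ← Real.log_mul (by positivity) (by positivity)]
    congr 1
    field_simp
  have hm1 : l + 1 / 3 ≤ m := by
    have h1 := Real.one_sub_inv_le_log_of_pos (x := 3 / 2) (by norm_num)
    have h2 : Real.log (3 / 2) ≤ Real.log (3 * n / 2) :=
      Real.log_le_log (by norm_num) (by linarith)
    norm_num at h1
    linarith
  have hm2 : 2 ≤ n → l + 1 ≤ m := fun h => by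
    have h' : (2 : ℝ) ≤ n := by exact_mod_cast h
    have h2 : Real.log 3 ≤ Real.log (3 * n / 2) :=
      Real.log_le_log (by norm_num) (by linarith)
    linarith [log_three_gt]
  have hm0 : 0 < m := by linarith
  set τ := ε ^ 2 / (8 * (L : ℝ) ^ 2 * m * l) with hτdef
  have hτ : 0 < τ := by positivity
  have hnoise : gradientNoise d n L ε δ = gaussianLaw τ 0 := gradientNoise_eq_gaussianLaw hτ
  have hν := isProbabilityMeasure_gaussianLaw hτ (0 : EuclideanSpace ℝ (Fin d))
  set θ := ε ^ 2 / (l * m) with hθ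
  have hθ0 : 0 ≤ θ := by positivity
  -- two gradients differ by at most `2 * L`
  have hdist : ∀ a b : EuclideanSpace ℝ (Fin d), ‖a‖ ≤ L → ‖b‖ ≤ L →
      2 * (τ * ‖a - b‖ ^ 2) ≤ θ := by
    intro a b ha hb
    have h1 : ‖a - b‖ ≤ 2 * L := (norm_sub_le a b).trans (by linarith)
    calc 2 * (τ * ‖a - b‖ ^ 2) ≤ 2 * (τ * (2 * L) ^ 2) := by gcongr
      _ = θ := by rw [hτdef, hθ]; field_simp; ring
  have hiter : ∀ S S' : Fin n → X, Neighboring S S' → ∀ t ≤ n ^ 2,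
      ∀ A : Set (EuclideanSpace ℝ (Fin d)), MeasurableSet A →
      noisySGDIterate f (gaussianLaw τ 0) η w₀ S t A ≤ ENNReal.ofReal (Real.exp ε) *
        noisySGDIterate f (gaussianLaw τ 0) η w₀ S' t A + ENNReal.ofReal δ := by
    intro S S' hS t ht A hA
    have hlk : l ≤ (⌊l / ε⌋₊ + 1) * ε := by
      rw [← div_le_iff₀ hε0]; exact (Nat.lt_floor_add_one _).le
    have hkl : ⌊l / ε⌋₊ * ε ≤ l := by
      rw [← le_div_iff₀ hε0]; exact Nat.floor_le (by positivity)
    rcases hn.eq_or_lt with rfl | hn2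
    · -- the order is `k + 1` with `k = max 1 ⌊l / ε⌋`
      obtain ⟨k, hk, hkl', hlk'⟩ : ∃ k : ℕ, 1 ≤ k ∧ (k * ε ≤ l ∨ k = 1 ∧ l ≤ ε) ∧
          l ≤ (k + 1) * ε := by
        rcases Nat.eq_zero_or_pos ⌊l / ε⌋₊ with h0 | h0
        · rw [h0] at hlk
          norm_num at hlk
          exact ⟨1, le_rfl, Or.inr ⟨rfl, hlk⟩, by norm_num; linarith⟩
        · exact ⟨_, h0, Or.inl hkl, hlk⟩
      refine measure_noisySGDIterate_le le_rfl hk (b := Real.exp (k * (k + 1) * θ / 2))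
        (Real.one_le_exp (by positivity))
        (densityMomentLE_noisySGDStep_one hk hτ hf_lip (fun a b ha hb => ?_) S S') ?_ η w₀ ht hA
      · refine (integratesTo_gaussianDensity_pow_div hτ k a b).lintegral_le (fun x => ?_)
          (fun x => le_rfl) (Real.exp_le_exp.2 ?_)
        · have := gaussianDensity_pos hτ a x
          have := gaussianDensity_pos hτ b x
          positivity
        · have := hdist a b ha hb
          have hkk : (0 : ℝ) ≤ k * (k + 1) := by positivity
          nlinarith
      · rw [one_pow, pow_one]
        exact exp_le_of_add_log_le_log hδ0
          (gaussian_budget hk hl2 hm1 hε0 hε1 hkl' hlk')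
    · have hp0 : (0 : ℝ) ≤ 1 / n := by positivity
      have hp1 : 1 / (n : ℝ) ≤ 1 := by rw [div_le_one (by linarith)]; exact hn'
      rcases le_or_gt 2 ⌊l / ε⌋₊ with hk | hk
      · set k := ⌊l / ε⌋₊
        set K := 2 * (Real.exp (k * (k + 1) * θ / 2) - 1) + k * (k + 1) * (Real.exp θ - 1)
        have hK : 0 ≤ K := by
          have h1 : 1 ≤ Real.exp (k * (k + 1) * θ / 2) := Real.one_le_exp (by positivity)
          have h2 : 0 ≤ k * (k + 1) * (Real.exp θ - 1) :=
            mul_nonneg (by positivity) (by linarith [Real.one_le_exp hθ0])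
          simp only [K]
          linarith
        exact measure_noisySGDIterate_le hn (by omega) (b := 1 + (1 / (n : ℝ)) ^ 2 * K)
          (by have : 0 ≤ (1 / (n : ℝ)) ^ 2 * K := by positivity
              linarith)
          (densityMomentLE_noisySGDStep (by omega) hn2 hτ hf_lip (fun a b c ha hb hc =>
            lintegral_mixture_pow_div_le hτ k hp0 hp1 (hdist a b ha hb) (hdist a c ha hc)
              (hdist b c hb hc)) hS)
          ((one_add_div_pow_le_exp hn hK).trans
            (exp_le_of_add_log_le_log hδ0 (moment_budget hk (hm2 hn2) hε0 hε1 hkl hlk)))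
          η w₀ ht hA
      · have hlε : l ≤ 2 * ε := by
          have : (⌊l / ε⌋₊ : ℝ) ≤ 1 := by exact_mod_cast Nat.lt_succ_iff.1 hk
          nlinarith
        set K := 2 * Real.exp θ - 2 * Real.exp (θ / 2)
        have hK : 0 ≤ K := by
          have : Real.exp (θ / 2) ≤ Real.exp θ := Real.exp_le_exp.2 (by linarith)
          simp only [K]
          linarith
        refine measure_noisySGDIterate_le hn le_rfl (b := 1 + (1 / (n : ℝ)) ^ 2 * K)
          (by have : 0 ≤ (1 / (n : ℝ)) ^ 2 * K := by positivity
              linarith)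
          (densityMomentLE_noisySGDStep le_rfl hn2 hτ hf_lip (fun a b c ha hb hc => ?_) hS)
          ((one_add_div_pow_le_exp hn hK).trans (exp_le_of_add_log_le_log hδ0 ?_)) η w₀ ht hA
        · simpa only [pow_one] using lintegral_mixture_sq_div_le hτ hp0 hp1 (hdist a b ha hb)
            (hdist a c ha hc) (hdist b c hb hc)
        · have := chiSq_budget hl2 (hm2 hn2) hε0 hε1 hlε
          rw [← hθ] at this
          norm_num
          simp only [K]
          linarith
  refine ⟨fun S => ?_, fun S S' hS A hA => ?_⟩
  · rw [randomRoundPrivateSGD, hnoise]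
    exact isProbabilityMeasure_bind (measurable_of_countable _).aemeasurable
      (ae_of_all _ fun t => isProbabilityMeasure_noisySGDIterate hn _ η w₀ S t)
  · simp only [randomRoundPrivateSGD, hnoise]
    exact measure_bind_le P hA fun t ht => hiter S S' hS t (hP ht).2 A hA
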